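/- Let $l,p,\omega$ be real with $p^2+l^2=1$, $-1<l<0$, $p>0$, $\omega>0$, and put $$E=E_1+iE_2=\frac{l+ip}{2\omega}\quad(E_1<0<E_2),\qquad \omega_0>0,\quad \omega_0^2=\frac{-8l^3\omega^2}{27-18l^2-l^4+(9-l^2)\sqrt{(1-l^2)(9-l^2)}}.$$ Then for every $\xi$ with $\frac1{2\omega}<\xi<\xi_0:=\frac1{2\omega_0}$ there is exactly one triple $(\lambda_-,\lambda_+,d)$ of real numbers $\lambda_-<\lambda_+$ and a complex number $d=d_1+id_2$ with $d_2>0$ such that $$\lambda_-+\lambda_+=E_1-d_1,\qquad \lambda_-\lambda_+=-\xi^2\frac{|E|}{|d|},$$ $$2\lambda_-\lambda_+d_1+(\lambda_-+\lambda_+)|d|^2=-\xi^2\left(\frac{E_1}{|E|}|d|+\frac{d_1}{|d|}|E|\right),$$ $$\int_E^{\overline E}d\widehat g=0,\qquad d\widehat g=\frac{(k-\lambda_-)(k-\lambda_+)}{4\xi^2k^2}\sqrt{\frac{(k-d)(k-\overline d)}{(k-E)(k-\overline E)}}\,dk .$$ Here the square root is the branch in the plane cut along the segments $[E,d]$ and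 $[\overline E,\overline d]$ that tends to $1$ as $k\to\infty$, and the (absolutely convergent) integral is taken along the straight segment from $E$ to $\overline E$. Thus the system determines $\lambda_\pm$ and $d$ uniquely as functions of $\xi\in\left(\frac1{2\omega},\xi_0\right)$. -/

import Mathlib

open scoped ComplexConjugate

noncomputable section

namespace RamanWhitham

/-- The spectral end point `E = (l + i p) / (2 ω)`. -/
def endPoint (l p ω : ℝ) : ℂ := ((l : ℂ) + (p : ℂ) * Complex.I) / (2 * (ω : ℂ))

/-- The positive number `ω₀` with
`ω₀² = -8 l³ ω² / (27 - 18 l² - l⁴ + (9 - l²) √((1 - l²) (9 - l²)))`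
(the right-hand side is positive for `-1 < l < 0` and `ω ≠ 0`). -/
def omegaZero (l ω : ℝ) : ℝ :=
  Real.sqrt (-8 * l ^ 3 * ω ^ 2 /
    (27 - 18 * l ^ 2 - l ^ 4 + (9 - l ^ 2) * Real.sqrt ((1 - l ^ 2) * (9 - l ^ 2))))

/-- The branch of `√((k - d)(k - d̄) / ((k - E)(k - Ē)))` in the plane cut along the two
segments `[E, d]` and `[Ē, d̄]` which tends to `1` as `k → ∞`. With the principal power,
`((k - d) / (k - E)) ^ (1 / 2)` jumps exactly where `(k - d) / (k - E)` is a negative real,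
that is, on the open segment from `E` to `d`; likewise for the conjugate factor. The product
is positive on the real axis. -/
def rootRatio (E d k : ℂ) : ℂ :=
  ((k - d) / (k - E)) ^ (1 / 2 : ℂ) * ((k - conj d) / (k - conj E)) ^ (1 / 2 : ℂ)

/-- The density of the Abelian differential
`dĝ = (k - λ₋)(k - λ₊) / (4 ξ² k²) · √((k - d)(k - d̄) / ((k - E)(k - Ē))) dk`. -/
def gHatDensity (E : ℂ) (ξ lm lp : ℝ) (d k : ℂ) : ℂ :=
  (k - (lm : ℂ)) * (k - (lp : ℂ)) / (4 * (ξ : ℂ) ^ 2 * k ^ 2) * rootRatio E d k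

/-- The integrand of `∫ dĝ` pulled back to the straight path `s ↦ E + s (Ē - E)`, `0 ≤ s ≤ 1`,
from `E` to `Ē`. -/
def gHatPullback (E : ℂ) (ξ lm lp : ℝ) (d : ℂ) (s : ℝ) : ℂ :=
  gHatDensity E ξ lm lp d (E + (s : ℂ) * (conj E - E)) * (conj E - E)

/-- `(λ₋, λ₊, d)` with `λ₋ < λ₊`, `Im d > 0` solves the Whitham type system at `ξ`. -/
structure IsWhithamSolution (E : ℂ) (ξ lm lp : ℝ) (d : ℂ) : Prop where
  lt : lm < lp
  im_pos : 0 < d.im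
  sum_eq : lm + lp = E.re - d.re
  prod_eq : lm * lp = -ξ ^ 2 * (‖E‖ / ‖d‖)
  third_eq : 2 * (lm * lp) * d.re + (lm + lp) * ‖d‖ ^ 2 =
    -ξ ^ 2 * (E.re / ‖E‖ * ‖d‖ + d.re / ‖d‖ * ‖E‖)
  /-- The end-point singularities of the integral of `dĝ` from `E` to `Ē` are integrable. -/
  integrable : IntervalIntegrable (gHatPullback E ξ lm lp d) MeasureTheory.volume 0 1
  integral_eq : ∫ s in (0 : ℝ)..1, gHatPullback E ξ lm lp d s = 0

end RamanWhitham

end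

/-!
By scaling one may assume `|E| = 1`, so that `E = l + i p`; then `ξ` becomes `2 ω ξ > 1`. Write
`y = ξ²` for the rescaled value and `u = 1 / |d|`. The three algebraic equations say that the
differential behaves like `dk / (4 ξ²)` at `∞` and like `-dk / (4 k²)` at `0`, without residues.
They are equivalent to
`Re d = branchRe l y u`, `λ₋ + λ₊ = l - Re d`, `λ₋ λ₊ = -y u`, so that `u` is the only unknown
(`isWhithamSolution_unit_iff`). The bound `ξ < ξ₀` is exactly what makes `|Re d| < |d|` for all
`u > 0` (`gap_of_lt`), that is, a non-real `d` exists for every `u`.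

On the segment `k = l + i t`, `|t| < p`, the square root is
`√((k - d)(k - d̄)) / √(p² - t²)` with the principal root, and `(k - d)(k - d̄)` stays in the slit
plane. Up to a nonzero factor the remaining equation reads `segIntegral l p y u = 0`.

Uniqueness: since the principal parts at `0` and `∞` do not depend on `u`, the derivative of the
differential with respect to `u` is holomorphic on the elliptic curve, hence it is
`-C(u) dk / √((k - E)(k - Ē)(k - d)(k - d̄))` up to a positive factor
(`hasDerivAt_regDensity_div`). The coefficient `C(u)` is positive (`holoCoeff_pos`), and on the
segment the real part of `1 / √((k - d)(k - d̄))` is positive. Thus the real part of the integrand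
is strictly decreasing in `u` pointwise (`strictAntiOn_re_regDensity_div`), and so is its integral.

Existence: after multiplication by `u` the integral extends continuously to `u = 0`, where it is
positive; at `u = 1`, where `d = E`, it is `2 p (1 - y) < 0`. The intermediate value theorem gives a
zero of the real part, and the imaginary part vanishes by the symmetry `k ↦ k̄`.
-/

open scoped ComplexConjugate

namespace RamanWhitham

/-! ### The real part of the branch point as a function of `u = 1 / |d|` -/

/-- The real part of the branch point `d` of modulus `1 / u` which the algebraic equations force
when `|E| = 1`, `Re E = l` and `y = ξ²`. It is defined at `u = 0` as well, where it equals `l`. -/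
noncomputable def branchRe (l y u : ℝ) : ℝ := l * (1 + y * u) / (1 + y * u ^ 3)

/-- The derivative of `branchRe l y` with respect to `u`. -/
noncomputable def branchReDeriv (l y u : ℝ) : ℝ :=
  l * y * (1 - 3 * u ^ 2 - 2 * y * u ^ 3) / (1 + y * u ^ 3) ^ 2

/-- The coefficient `C(u)` of the holomorphic differential that arises as minus the derivative of
the Whitham differential with respect to `u`. -/
noncomputable def holoCoeff (l y u : ℝ) : ℝ :=
  y * u + 1 / u ^ 2 - u * branchReDeriv l y u * (l - 3 * branchRe l y u)

lemma hasDerivAt_branchRe (l : ℝ) {y u : ℝ} (hy : 0 < y) (hu : 0 ≤ u) :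
    HasDerivAt (branchRe l y) (branchReDeriv l y u) u := by
  have hA : 1 + y * u ^ 3 ≠ 0 := by positivity
  have h1 : HasDerivAt (fun u : ℝ => l * (1 + y * u)) (l * y) u := by
    simpa using (((hasDerivAt_id u).const_mul y).const_add 1).const_mul l
  have h2 : HasDerivAt (fun u : ℝ => 1 + y * u ^ 3) (y * (3 * u ^ 2)) u := by
    simpa using ((hasDerivAt_pow 3 u).const_mul y).const_add 1
  refine (h1.div h2 hA).congr_deriv ?_
  rw [branchReDeriv]
  congr 1
  ring

/-- Once denominators are cleared, the coefficient is affine in `l ^ 2`; it is positive at `l = 0`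
and, up to a positive factor, a perfect square at the value of `l ^ 2` at which `d` becomes real,
hence positive in between. -/
lemma holoCoeff_pos {l y u : ℝ} (hy : 0 < y) (hu : 0 < u)
    (hgap : -l * u * (1 + y * u) < 1 + y * u ^ 3) (hl : l < 0) : 0 < holoCoeff l y u := by
  have hA : 0 < 1 + y * u ^ 3 := by positivity
  have hsq : 0 < (1 + y * u ^ 3) ^ 2 - l ^ 2 * (u ^ 2 * (1 + y * u) ^ 2) := by
    have h2 : 0 < (1 + y * u ^ 3) - l * u * (1 + y * u) := by
      have : 0 < -l * u * (1 + y * u) := by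
        have := neg_pos.mpr hl
        positivity
      linarith
    nlinarith [mul_pos h2 (sub_pos.mpr hgap)]
  have key : holoCoeff l y u * (u ^ 2 * (1 + y * u ^ 3) ^ 3) =
      (1 + y * u ^ 3) ^ 2 * ((1 + y * u ^ 3) ^ 2 - l ^ 2 * (u ^ 2 * (1 + y * u) ^ 2))
      + l ^ 2 * u ^ 2 * (1 + 2 * y * u - 2 * y * u ^ 3 - y ^ 2 * u ^ 4) ^ 2 := by
    rw [holoCoeff, branchReDeriv, branchRe]
    field_simp
    ring
  refine pos_of_mul_pos_left (b := u ^ 2 * (1 + y * u ^ 3) ^ 3) ?_ (by positivity)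
  rw [key]
  positivity

/-- The inequality `|Re d| < |d|` for all `u`, from the bound defining `ξ₀` (with `c = -l`). In
terms of `r = 1 / u` it says that the cubic `r³ - c r² - c y r + y` is positive for `r > 0`. The
bound is the value of `y` at which this cubic acquires a double positive root. -/
lemma gap_of_lt {c y u : ℝ} (hc0 : 0 < c) (hc1 : c < 1) (hy : 1 < y) (hu : 0 < u)
    (h : 8 * c ^ 3 * y <
      27 - 18 * c ^ 2 - c ^ 4 + (9 - c ^ 2) * Real.sqrt ((1 - c ^ 2) * (9 - c ^ 2))) :
    c * u * (1 + y * u) < 1 + y * u ^ 3 := by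
  set s := Real.sqrt ((1 - c ^ 2) * (9 - c ^ 2)) with hs
  have hs0 : 0 ≤ s := Real.sqrt_nonneg _
  have hs2 : s ^ 2 = (1 - c ^ 2) * (9 - c ^ 2) :=
    Real.sq_sqrt (mul_nonneg (by nlinarith) (by nlinarith))
  -- Pass to `r = 1 / u`.
  suffices H : ∀ r : ℝ, 0 < r → c * r * (r + y) < r ^ 3 + y by
    have := H u⁻¹ (inv_pos.mpr hu)
    have h3 : 0 < u ^ 3 := by positivity
    have := mul_lt_mul_of_pos_right this h3
    field_simp at this
    nlinarith
  intro r hr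
  rcases le_or_gt (c * r) 1 with hcr | hcr
  · rcases le_or_gt c r with h1 | h1
    · rcases eq_or_lt_of_le hcr with h2 | h2
      · have : c < r := by nlinarith
        nlinarith [mul_pos (pow_pos hr 2) (sub_pos.mpr this)]
      · nlinarith [mul_nonneg (pow_pos hr 2).le (sub_nonneg.mpr h1),
          mul_pos (by linarith : (0:ℝ) < y) (sub_pos.mpr h2)]
    · have hr1 : r ^ 2 < 1 := by nlinarith
      have e1 : 0 < 1 - c * r := by nlinarith
      have e2 : c - r < 1 - c * r := by
        nlinarith [mul_pos (sub_pos.mpr hc1) (by linarith : 0 < 1 + r)]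
      nlinarith [mul_pos (sub_pos.mpr hy) e1, mul_pos (sub_pos.mpr hr1) (sub_pos.mpr h1)]
  -- For `c r > 1` the cubic decreases with `y`; `m` is its double root at the critical `y`.
  · have hcr' : c < r := by nlinarith
    set m := (3 + c ^ 2 + s) / (4 * c) with hm
    have hm0 : 0 < m := by positivity
    have hsq : 0 ≤ (r - m) ^ 2 * (r + 2 * m - c) :=
      mul_nonneg (sq_nonneg _) (by linarith)
    have hquad : 2 * c * m ^ 2 - (3 + c ^ 2) * m + 2 * c = 0 := by
      rw [hm]; field_simp; nlinarith
    have hx : 8 * c ^ 3 * (m ^ 2 * (2 * m - c)) = 27 - 18 * c ^ 2 - c ^ 4 + (9 - c ^ 2) * s := by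
      rw [hm]; field_simp
      linear_combination 16 * (9 + c ^ 2 + s) * hs2
    clear_value m
    have hyx : y < m ^ 2 * (2 * m - c) := by
      have : 0 < 8 * c ^ 3 := by positivity
      nlinarith
    have hexp : (r - m) ^ 2 * (r + 2 * m - c)
        = r ^ 3 - c * r ^ 2 - (m ^ 2 * (2 * m - c)) * (c * r - 1) := by
      linear_combination (m * r) * hquad
    nlinarith [mul_pos (sub_pos.mpr hyx) (sub_pos.mpr hcr)]

/-- The branch point lies on the line `Re k = l` only for `u = 1`, when it coincides with `E`. -/
lemma eq_one_of_branchRe_eq {l y u : ℝ} (hl : l < 0) (hy : 0 < y) (hu : 0 < u)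
    (h : branchRe l y u = l) : u = 1 := by
  have hA : 0 < 1 + y * u ^ 3 := by positivity
  rw [branchRe, div_eq_iff hA.ne'] at h
  have h1 := mul_left_cancel₀ hl.ne h
  have h2 : y * u * (u - 1) * (u + 1) = 0 := by linarith
  have h3 : y * u ≠ 0 := by positivity
  have h4 : u + 1 ≠ 0 := by positivity
  rcases mul_eq_zero.mp h2 with h2 | h2
  · rcases mul_eq_zero.mp h2 with h2 | h2
    · exact absurd h2 h3
    · linarith
  · exact absurd h2 h4

lemma sq_mul_branchRe_lt_one {l y u : ℝ} (hl : l < 0) (hy : 0 < y) (hu : 0 < u)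
    (hgap : -l * u * (1 + y * u) < 1 + y * u ^ 3) : (u * branchRe l y u) ^ 2 < 1 := by
  have hA : 0 < 1 + y * u ^ 3 := by positivity
  rw [sq_lt_one_iff_abs_lt_one, branchRe, abs_lt, ← mul_div_assoc, lt_div_iff₀ hA, div_lt_iff₀ hA]
  have : 0 < -l * u * (1 + y * u) := by
    have := neg_pos.mpr hl
    positivity
  constructor <;> nlinarith

/-! ### Principal powers of complex numbers -/

open Complex

lemma mul_cpow_of_arg_add_mem {x y : ℂ} (hx : x ≠ 0) (hy : y ≠ 0)
    (h : arg x + arg y ∈ Set.Ioc (-Real.pi) Real.pi) (c : ℂ) :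
    (x * y) ^ c = x ^ c * y ^ c := by
  rw [cpow_def_of_ne_zero (mul_ne_zero hx hy), cpow_def_of_ne_zero hx, cpow_def_of_ne_zero hy,
    (log_mul_eq_add_log_iff hx hy).mpr h, add_mul, exp_add]

lemma mul_cpow_of_im_neg {x y : ℂ} (h : 0 < x.im ∧ y.im < 0) (c : ℂ) :
    (x * y) ^ c = x ^ c * y ^ c := by
  have hx : x ≠ 0 := fun h0 => by simp [h0] at h
  have hy : y ≠ 0 := fun h0 => by simp [h0] at h
  refine mul_cpow_of_arg_add_mem hx hy ⟨?_, ?_⟩ c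
  · linarith [arg_nonneg_iff.mpr h.1.le, neg_pi_lt_arg y]
  · linarith [arg_neg_iff.mpr h.2, arg_le_pi x]

/-- Numbers on opposite sides of the real axis, or both positive, have arguments whose sum stays
in `(-π, π)`. -/
lemma mul_cpow_of_opposite {x y : ℂ} (h : (0 < x.im ∧ y.im < 0) ∨ (x.im < 0 ∧ 0 < y.im) ∨
    (x.im = 0 ∧ y.im = 0 ∧ 0 < x.re ∧ 0 < y.re)) (c : ℂ) : (x * y) ^ c = x ^ c * y ^ c := by
  rcases h with h | h | ⟨hx, hy, hx', hy'⟩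
  · exact mul_cpow_of_im_neg h c
  · rw [mul_comm, mul_cpow_of_im_neg h.symm c, mul_comm]
  · have ex : x = (x.re : ℂ) := Complex.ext rfl (by simpa using hx)
    have ey : y = (y.re : ℂ) := Complex.ext rfl (by simpa using hy)
    rw [ex, ey, mul_cpow_ofReal_nonneg hx'.le hy'.le]

lemma re_cpow_neg_half_pos {z : ℂ} (hz : z ∈ slitPlane) : 0 < (z ^ (-(1 / 2) : ℂ)).re := by
  rw [mem_slitPlane_iff_arg] at hz
  rw [cpow_def_of_ne_zero hz.2, exp_re]
  have him : (log z * (-(1 / 2) : ℂ)).im = -(arg z / 2) := by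
    have : (-(1 / 2) : ℂ) = ((-(1 / 2) : ℝ) : ℂ) := by push_cast; rfl
    rw [this, im_mul_ofReal, log_im]; ring
  rw [him, Real.cos_neg]
  have h1 := neg_pi_lt_arg z
  have h2 := lt_of_le_of_ne (arg_le_pi z) hz.1
  exact mul_pos (Real.exp_pos _) (Real.cos_pos_of_mem_Ioo ⟨by linarith, by linarith⟩)

/-! ### The integrand on the segment from `E` to `Ē` -/

/-- The point at parameter `s` of the segment from `l + i p` to `l - i p`. -/
noncomputable def segPoint (l p s : ℝ) : ℂ := (l : ℂ) + ((p * (1 - 2 * s) : ℝ) : ℂ) * I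

/-- The polynomial `(k - λ₋)(k - λ₊)`, with the coefficients given by the algebraic equations. -/
noncomputable def zeroPoly (l y u : ℝ) (k : ℂ) : ℂ :=
  k ^ 2 - ((l - branchRe l y u : ℝ) : ℂ) * k - ((y * u : ℝ) : ℂ)

/-- The polynomial `(k - d)(k - d̄)` multiplied by `u ^ 2`, which makes it regular at `u = 0`. -/
noncomputable def radPoly (l y u : ℝ) (k : ℂ) : ℂ :=
  (u : ℂ) ^ 2 * (k ^ 2 - 2 * (branchRe l y u : ℂ) * k) + 1

/-- The `u`-dependent part of the Whitham density on the segment, multiplied by `u` to be regular at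
`u = 0`; the factor `1 / √((k - E)(k - Ē))` and constants are left out. -/
noncomputable def regDensity (l y u : ℝ) (k : ℂ) : ℂ :=
  zeroPoly l y u k * radPoly l y u k ^ (1 / 2 : ℂ) / k ^ 2

/-- The factor `1 / √((k - E)(k - Ē))` on the segment, up to the constant `2 p`. At the end
points it is `0` by the convention for inverses. -/
noncomputable def weight (s : ℝ) : ℝ := (√(s * (1 - s)))⁻¹

lemma segPoint_ne_zero {l : ℝ} (hl : l < 0) (p s : ℝ) : segPoint l p s ≠ 0 := by
  intro h
  have := congrArg re h
  simp [segPoint] at this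
  exact hl.ne this

lemma radPoly_segPoint (l p y u s : ℝ) : radPoly l y u (segPoint l p s) =
    ((u ^ 2 * (l ^ 2 - (p * (1 - 2 * s)) ^ 2 - 2 * branchRe l y u * l) + 1 : ℝ) : ℂ) +
    ((2 * u ^ 2 * (p * (1 - 2 * s)) * (l - branchRe l y u) : ℝ) : ℂ) * I := by
  rw [radPoly, segPoint]; push_cast
  linear_combination (u : ℂ) ^ 2 * ((p : ℂ) * (1 - 2 * s)) ^ 2 * I_sq

lemma radPoly_re (l p y u s : ℝ) : (radPoly l y u (segPoint l p s)).re =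
    u ^ 2 * (l ^ 2 - (p * (1 - 2 * s)) ^ 2 - 2 * branchRe l y u * l) + 1 := by
  rw [radPoly_segPoint, add_re, re_ofReal_mul, ofReal_re, I_re, mul_zero, add_zero]

lemma radPoly_im (l p y u s : ℝ) : (radPoly l y u (segPoint l p s)).im =
    2 * u ^ 2 * (p * (1 - 2 * s)) * (l - branchRe l y u) := by
  rw [radPoly_segPoint, add_im, im_ofReal_mul, ofReal_im, I_im, mul_one, zero_add]

/-- On the open segment the imaginary part of `(k - d)(k - d̄)` is a multiple of
`t (l - Re d)`; where it vanishes the real part is positive. -/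
lemma radPoly_mem_slitPlane {l p y u s : ℝ} (hlp : p ^ 2 + l ^ 2 = 1) (hl : l < 0) (hp : 0 < p)
    (hy : 0 < y) (hu : 0 ≤ u) (hgap : -l * u * (1 + y * u) < 1 + y * u ^ 3)
    (hs : s ∈ Set.Ioo (0 : ℝ) 1) : radPoly l y u (segPoint l p s) ∈ slitPlane := by
  rw [mem_slitPlane_iff, radPoly_re, radPoly_im]
  by_cases him : 2 * u ^ 2 * (p * (1 - 2 * s)) * (l - branchRe l y u) = 0
  swap
  · exact Or.inr him
  left
  rcases hu.eq_or_lt with rfl | hu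
  · simp
  rcases mul_eq_zero.mp him with h | h
  · have hs' : p * (1 - 2 * s) = 0 := by
      rcases mul_eq_zero.mp h with h | h
      · exact absurd h (by positivity)
      · exact h
    rw [hs']
    nlinarith [sq_mul_branchRe_lt_one hl hy hu hgap, sq_nonneg (u * (l - branchRe l y u))]
  · have h1 : branchRe l y u = l := by linarith
    have h2 := eq_one_of_branchRe_eq hl hy hu h1
    rw [h1, h2]
    nlinarith [mul_pos (mul_pos hp hp) (mul_pos hs.1 (sub_pos.mpr hs.2))]

/-- The derivative has no pole at `k = 0`: the principal part there is independent of `u`, and the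
powers of `k` in the denominator cancel. -/
lemma hasDerivAt_regDensity_div {l y u : ℝ} {k : ℂ} (hy : 0 < y) (hu : 0 < u) (hk : k ≠ 0)
    (hslit : radPoly l y u k ∈ slitPlane) :
    HasDerivAt (fun u : ℝ => regDensity l y u k / (u : ℂ))
      (-(holoCoeff l y u : ℂ) * radPoly l y u k ^ (-(1 / 2) : ℂ)) u := by
  have hα := (hasDerivAt_branchRe l hy hu.le).ofReal_comp
  have hid : HasDerivAt (fun u : ℝ => (u : ℂ)) 1 u := by
    simpa using (hasDerivAt_id u).ofReal_comp
  have hN : HasDerivAt (fun u : ℝ => zeroPoly l y u k)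
      ((branchReDeriv l y u : ℂ) * k - (y : ℂ)) u := by
    have := (((hα.const_sub (l : ℂ)).mul_const k).const_sub (k ^ 2)).sub (hid.const_mul (y : ℂ))
    refine (this.congr_of_eventuallyEq (Filter.Eventually.of_forall fun v => ?_)).congr_deriv ?_
    · simp [zeroPoly]
    · ring
  have hD : HasDerivAt (fun u : ℝ => radPoly l y u k)
      (2 * (u : ℂ) * (k ^ 2 - 2 * (branchRe l y u : ℂ) * k)
        + (u : ℂ) ^ 2 * (-2 * (branchReDeriv l y u : ℂ) * k)) u := by
    have := ((hid.pow 2).mul (((hα.const_mul 2).mul_const k).const_sub (k ^ 2))).add_const 1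
    refine (this.congr_of_eventuallyEq (Filter.Eventually.of_forall fun v => ?_)).congr_deriv ?_
    · simp [radPoly]
    · simp
  have hc : HasDerivAt (fun z : ℂ => z ^ (1 / 2 : ℂ))
      (1 / 2 * radPoly l y u k ^ ((1 / 2 : ℂ) - 1) * 1) (radPoly l y u k) :=
    (hasDerivAt_id (radPoly l y u k)).cpow_const hslit
  have hR := hc.comp u hD
  have h := ((hN.mul hR).div_const (k ^ 2)).div hid (by exact_mod_cast hu.ne')
  refine (h.congr_of_eventuallyEq (Filter.Eventually.of_forall fun v => rfl)).congr_deriv ?_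
  have hD0 := slitPlane_ne_zero hslit
  have e1 : radPoly l y u k ^ (1 / 2 : ℂ) = radPoly l y u k ^ (-(1 / 2) : ℂ) * radPoly l y u k := by
    nth_rw 3 [← cpow_one (radPoly l y u k)]
    rw [← cpow_add _ _ hD0]; norm_num
  have e2 : (1 / 2 : ℂ) - 1 = -(1 / 2) := by norm_num
  have hu' : (u : ℂ) ≠ 0 := by exact_mod_cast hu.ne'
  -- The coefficient of `k` in the numerator of the derivative, which has to vanish.
  have hcoef : (branchReDeriv l y u * (1 / u + y * u ^ 2) + 2 * y * u * branchRe l y u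
      + (l - branchRe l y u) / u ^ 2 : ℝ) = 0 := by
    have hA : 1 + y * u ^ 3 ≠ 0 := by positivity
    rw [branchReDeriv, branchRe]
    field_simp
    ring
  have hcoef' : (branchReDeriv l y u : ℂ) * (1 / u + y * u ^ 2) + 2 * y * u * branchRe l y u
      + (l - branchRe l y u) / u ^ 2 = 0 := by exact_mod_cast hcoef
  simp only [Pi.mul_apply, Function.comp_apply, e2, e1]
  generalize radPoly l y u k ^ (-(1 / 2) : ℂ) = W
  rw [holoCoeff, radPoly, zeroPoly]
  push_cast
  generalize (branchRe l y u : ℂ) = α at *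
  generalize (branchReDeriv l y u : ℂ) = α' at *
  field_simp at hcoef' ⊢
  linear_combination W * k * hcoef'

lemma strictAntiOn_re_regDensity_div {l p y s : ℝ} (hlp : p ^ 2 + l ^ 2 = 1) (hl : l < 0)
    (hp : 0 < p) (hy : 0 < y)
    (hgap : ∀ u : ℝ, 0 < u → -l * u * (1 + y * u) < 1 + y * u ^ 3)
    (hs : s ∈ Set.Ioo (0 : ℝ) 1) :
    StrictAntiOn (fun u : ℝ => (regDensity l y u (segPoint l p s) / (u : ℂ)).re) (Set.Ioi 0) := by
  have hslit : ∀ u : ℝ, 0 < u → radPoly l y u (segPoint l p s) ∈ slitPlane := fun u hu =>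
    radPoly_mem_slitPlane hlp hl hp hy hu.le (hgap u hu) hs
  have hder : ∀ u : ℝ, 0 < u → HasDerivAt
      (fun u : ℝ => (regDensity l y u (segPoint l p s) / (u : ℂ)).re)
      (-(holoCoeff l y u) * (radPoly l y u (segPoint l p s) ^ (-(1 / 2) : ℂ)).re) u := by
    intro u hu
    have h := reCLM.hasFDerivAt.comp_hasDerivAt u
      (hasDerivAt_regDensity_div hy hu (segPoint_ne_zero hl p s) (hslit u hu))
    refine h.congr_deriv ?_
    rw [reCLM_apply, ← ofReal_neg, re_ofReal_mul]
  refine strictAntiOn_of_deriv_neg (convex_Ioi 0)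
    (fun u hu => (hder u hu).continuousAt.continuousWithinAt) fun u hu => ?_
  rw [interior_Ioi] at hu
  rw [(hder u hu).deriv]
  have := mul_pos (holoCoeff_pos hy hu (hgap u hu) hl) (re_cpow_neg_half_pos (hslit u hu))
  linarith

/-! ### The integral along the segment -/

lemma weight_pos {s : ℝ} (hs : s ∈ Set.Ioo (0 : ℝ) 1) : 0 < weight s :=
  inv_pos.mpr (Real.sqrt_pos.mpr (mul_pos hs.1 (sub_pos.mpr hs.2)))

lemma weight_nonneg (s : ℝ) : 0 ≤ weight s := inv_nonneg.mpr (Real.sqrt_nonneg _)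

/-- Integrability is that of the Beta integral with parameters `1 / 2`, `1 / 2`. -/
lemma intervalIntegrable_weight : IntervalIntegrable weight MeasureTheory.volume 0 1 := by
  have h := (betaIntegral_convergent (u := ((1 / 2 : ℝ) : ℂ)) (v := ((1 / 2 : ℝ) : ℂ))
    (by rw [ofReal_re]; norm_num) (by rw [ofReal_re]; norm_num)).norm
  refine h.congr_uIoo fun s hs => ?_
  rw [Set.uIoo_of_le zero_le_one] at hs
  have h1 : 0 < 1 - s := sub_pos.mpr hs.2
  have e1 : ((1 / 2 : ℝ) : ℂ) - 1 = ((-(1 / 2) : ℝ) : ℂ) := by push_cast; norm_num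
  have e2 : (1 : ℂ) - (s : ℂ) = ((1 - s : ℝ) : ℂ) := by push_cast; rfl
  simp only [weight]
  rw [e1, e2, norm_mul, norm_cpow_real, norm_cpow_real, norm_real, norm_real,
    Real.norm_of_nonneg hs.1.le, Real.norm_of_nonneg h1.le, ← Real.mul_rpow hs.1.le h1.le,
    Real.rpow_neg (mul_pos hs.1 h1).le, Real.sqrt_eq_rpow]

lemma continuous_segPoint (l p : ℝ) : Continuous (segPoint l p) := by
  unfold segPoint; fun_prop

lemma continuousAt_branchRe (l : ℝ) {y u : ℝ} (hy : 0 < y) (hu : 0 ≤ u) :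
    ContinuousAt (branchRe l y) u := (hasDerivAt_branchRe l hy hu).continuousAt

/-- The norm is continuous on the closed rectangle even where the radicand leaves the slit plane, as
it does at the end points of the segment for `u = 1`. -/
lemma exists_norm_regDensity_le {l p y : ℝ} (hl : l < 0) (hy : 0 < y) (B : ℝ) :
    ∃ M : ℝ, ∀ u ∈ Set.Icc 0 B, ∀ s ∈ Set.Icc (0 : ℝ) 1,
      ‖regDensity l y u (segPoint l p s)‖ ≤ M := by
  have hα : ContinuousOn (fun q : ℝ × ℝ => branchRe l y q.1)
      (Set.Icc 0 B ×ˢ Set.Icc (0 : ℝ) 1) := fun q hq =>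
    ((continuousAt_branchRe l hy hq.1.1).comp continuousAt_fst).continuousWithinAt
  have hk : Continuous (fun q : ℝ × ℝ => segPoint l p q.2) :=
    (continuous_segPoint l p).comp continuous_snd
  have hα' := continuous_ofReal.comp_continuousOn hα
  have hαl : ContinuousOn (fun q : ℝ × ℝ => ((l - branchRe l y q.1 : ℝ) : ℂ))
      (Set.Icc 0 B ×ˢ Set.Icc (0 : ℝ) 1) :=
    continuous_ofReal.comp_continuousOn (continuousOn_const.sub hα)
  have hN : ContinuousOn (fun q : ℝ × ℝ => zeroPoly l y q.1 (segPoint l p q.2))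
      (Set.Icc 0 B ×ˢ Set.Icc (0 : ℝ) 1) :=
    ((hk.continuousOn.pow 2).sub (hαl.mul hk.continuousOn)).sub
      (by fun_prop)
  have hD : ContinuousOn (fun q : ℝ × ℝ => radPoly l y q.1 (segPoint l p q.2))
      (Set.Icc 0 B ×ˢ Set.Icc (0 : ℝ) 1) :=
    ((show ContinuousOn (fun q : ℝ × ℝ => (q.1 : ℂ) ^ 2) _ by fun_prop).mul
      ((hk.continuousOn.pow 2).sub ((continuousOn_const.mul hα').mul hk.continuousOn))).add
      continuousOn_const
  have hF : ContinuousOn (fun q : ℝ × ℝ => ‖zeroPoly l y q.1 (segPoint l p q.2)‖ *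
      ‖radPoly l y q.1 (segPoint l p q.2)‖ ^ (1 / 2 : ℝ) / ‖segPoint l p q.2‖ ^ 2)
      (Set.Icc 0 B ×ˢ Set.Icc (0 : ℝ) 1) := by
    refine (hN.norm.mul (hD.norm.rpow_const fun _ _ => Or.inr (by norm_num))).div
      (hk.norm.pow 2).continuousOn fun q _ => ?_
    exact pow_ne_zero 2 (norm_ne_zero_iff.mpr (segPoint_ne_zero hl p q.2))
  obtain ⟨M, hM⟩ := (isCompact_Icc.prod isCompact_Icc).exists_bound_of_continuousOn hF
  refine ⟨M, fun u hu s hs => (le_of_eq ?_).trans ((le_abs_self _).trans (hM (u, s) ⟨hu, hs⟩))⟩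
  have e : (1 / 2 : ℂ) = ((1 / 2 : ℝ) : ℂ) := by push_cast; rfl
  rw [regDensity, norm_div, norm_mul, norm_pow, e, norm_cpow_real]

lemma measurable_regDensity_segPoint (l p y u : ℝ) :
    Measurable fun s : ℝ => regDensity l y u (segPoint l p s) := by
  have h := (continuous_segPoint l p).measurable
  unfold regDensity zeroPoly radPoly
  fun_prop

lemma measurable_weight : Measurable weight := by
  unfold weight; fun_prop

lemma intervalIntegrable_regDensity {l : ℝ} (p : ℝ) {y u : ℝ} (hl : l < 0) (hy : 0 < y)
    (hu : 0 ≤ u) : IntervalIntegrable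
      (fun s => regDensity l y u (segPoint l p s) * (weight s : ℂ)) MeasureTheory.volume 0 1 := by
  obtain ⟨M, hM⟩ := exists_norm_regDensity_le (p := p) hl hy u
  refine (intervalIntegrable_weight.const_mul M).mono_fun'
    ((measurable_regDensity_segPoint l p y u).mul
      (measurable_ofReal.comp measurable_weight)).aestronglyMeasurable ?_
  refine MeasureTheory.ae_restrict_of_forall_mem measurableSet_uIoc fun s hs => ?_
  rw [Set.uIoc_of_le zero_le_one] at hs
  simp only [norm_mul, norm_real, Real.norm_of_nonneg (weight_nonneg s)]
  exact mul_le_mul_of_nonneg_right (hM u ⟨hu, le_rfl⟩ s ⟨hs.1.le, hs.2⟩) (weight_nonneg s)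

/-- For `u = 1 / |d| > 0`, the integral of `dĝ` from `E` to `Ē` up to a nonzero factor; the value at
`u = 0` is its limit. -/
noncomputable def segIntegral (l p y u : ℝ) : ℂ :=
  ∫ s in (0 : ℝ)..1, regDensity l y u (segPoint l p s) * (weight s : ℂ)

lemma segIntegral_re {l : ℝ} (p : ℝ) {y u : ℝ} (hl : l < 0) (hy : 0 < y) (hu : 0 ≤ u) :
    (segIntegral l p y u).re =
      ∫ s in (0 : ℝ)..1, (regDensity l y u (segPoint l p s)).re * weight s := by
  rw [segIntegral, ← reCLM_apply,
    ← reCLM.intervalIntegral_comp_comm (intervalIntegrable_regDensity p hl hy hu)]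
  simp only [reCLM_apply, re_mul_ofReal]

lemma intervalIntegrable_re_regDensity {l : ℝ} (p : ℝ) {y u : ℝ} (hl : l < 0) (hy : 0 < y)
    (hu : 0 ≤ u) : IntervalIntegrable
      (fun s => (regDensity l y u (segPoint l p s)).re * weight s) MeasureTheory.volume 0 1 := by
  have h := intervalIntegrable_regDensity p hl hy hu
  have h2 := (intervalIntegrable_iff.mp h).re
  rw [intervalIntegrable_iff]
  refine h2.congr (Filter.Eventually.of_forall fun s => ?_)
  simp

lemma segIntegral_re_div_lt {l p y : ℝ} (hlp : p ^ 2 + l ^ 2 = 1) (hl : l < 0)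
    (hp : 0 < p) (hy : 0 < y)
    (hgap : ∀ u : ℝ, 0 < u → -l * u * (1 + y * u) < 1 + y * u ^ 3)
    {u v : ℝ} (hu : 0 < u) (huv : u < v) :
    (segIntegral l p y v).re / v < (segIntegral l p y u).re / u := by
  have hv := hu.trans huv
  rw [segIntegral_re p hl hy hu.le, segIntegral_re p hl hy hv.le, ← sub_pos,
    ← intervalIntegral.integral_div, ← intervalIntegral.integral_div,
    ← intervalIntegral.integral_sub]
  · refine intervalIntegral.intervalIntegral_pos_of_pos_on
      (((intervalIntegrable_re_regDensity p hl hy hu.le).div_const u).sub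
        ((intervalIntegrable_re_regDensity p hl hy hv.le).div_const v)) (fun s hs => ?_)
      zero_lt_one
    have h := strictAntiOn_re_regDensity_div hlp hl hp hy hgap hs hu hv huv
    simp only [div_ofReal_re] at h
    have := mul_pos (sub_pos.mpr h) (weight_pos hs)
    calc 0 < _ := this
      _ = _ := by ring
  · exact (intervalIntegrable_re_regDensity p hl hy hu.le).div_const u
  · exact (intervalIntegrable_re_regDensity p hl hy hv.le).div_const v

lemma conj_segPoint (l p s : ℝ) : conj (segPoint l p s) = segPoint l p (1 - s) := by
  rw [segPoint, segPoint, map_add, map_mul, conj_I, conj_ofReal, conj_ofReal]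
  push_cast; ring

lemma regDensity_conj {l y u : ℝ} {k : ℂ} (hk : radPoly l y u k ∈ slitPlane) :
    regDensity l y u (conj k) = conj (regDensity l y u k) := by
  have h1 : zeroPoly l y u (conj k) = conj (zeroPoly l y u k) := by
    simp only [zeroPoly, map_sub, map_mul, map_pow, conj_ofReal]
  have h2 : radPoly l y u (conj k) = conj (radPoly l y u k) := by
    simp only [radPoly, map_add, map_sub, map_mul, map_pow, conj_ofReal, map_one, map_ofNat]
  have h3 : conj (1 / 2 : ℂ) = 1 / 2 := by simp only [map_div₀, map_one, map_ofNat]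
  rw [regDensity, regDensity, h1, h2, conj_cpow _ _ (mem_slitPlane_iff_arg.mp hk).1, h3,
    map_div₀, map_mul, map_pow]

lemma weight_one_sub (s : ℝ) : weight (1 - s) = weight s := by
  rw [weight, weight]; congr 2; ring

/-- The reflection `s ↦ 1 - s` of the segment is complex conjugation, so the imaginary part of the
integrand is odd. -/
lemma segIntegral_im {l p y u : ℝ} (hlp : p ^ 2 + l ^ 2 = 1) (hl : l < 0)
    (hp : 0 < p) (hy : 0 < y) (hu : 0 ≤ u) (hgap : -l * u * (1 + y * u) < 1 + y * u ^ 3) :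
    (segIntegral l p y u).im = 0 := by
  have him : (segIntegral l p y u).im =
      ∫ s in (0 : ℝ)..1, (regDensity l y u (segPoint l p s)).im * weight s := by
    rw [segIntegral, ← imCLM_apply,
      ← imCLM.intervalIntegral_comp_comm (intervalIntegrable_regDensity p hl hy hu)]
    simp only [imCLM_apply, im_mul_ofReal]
  have hodd : (∫ s in (0 : ℝ)..1, (regDensity l y u (segPoint l p (1 - s))).im * weight (1 - s)) =
      ∫ s in (0 : ℝ)..1, (regDensity l y u (segPoint l p s)).im * weight s := by
    rw [intervalIntegral.integral_comp_sub_left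
      (fun s => (regDensity l y u (segPoint l p s)).im * weight s) 1]
    simp
  have hneg : (∫ s in (0 : ℝ)..1, (regDensity l y u (segPoint l p (1 - s))).im * weight (1 - s)) =
      -∫ s in (0 : ℝ)..1, (regDensity l y u (segPoint l p s)).im * weight s := by
    rw [← intervalIntegral.integral_neg]
    refine intervalIntegral.integral_congr_Ioo_of_le zero_le_one fun s hs => ?_
    have := regDensity_conj (radPoly_mem_slitPlane hlp hl hp hy hu hgap hs)
    simp only [← conj_segPoint, this, weight_one_sub, conj_im, neg_mul]
  rw [him]
  linarith

lemma continuousOn_segIntegral {l p y : ℝ} (hlp : p ^ 2 + l ^ 2 = 1) (hl : l < 0)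
    (hp : 0 < p) (hy : 0 < y)
    (hgap : ∀ u : ℝ, 0 < u → -l * u * (1 + y * u) < 1 + y * u ^ 3) :
    ContinuousOn (segIntegral l p y) (Set.Icc 0 1) := by
  obtain ⟨M, hM⟩ := exists_norm_regDensity_le (p := p) hl hy 1
  intro u₀ hu₀
  refine intervalIntegral.continuousWithinAt_of_dominated_interval
    (bound := fun s => M * weight s) ?_ ?_ (intervalIntegrable_weight.const_mul M) ?_
  · exact Filter.Eventually.of_forall fun u => ((measurable_regDensity_segPoint l p y u).mul
      (measurable_ofReal.comp measurable_weight)).aestronglyMeasurable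
  · filter_upwards [self_mem_nhdsWithin] with u hu
    refine Filter.Eventually.of_forall fun s hs => ?_
    rw [Set.uIoc_of_le zero_le_one] at hs
    simp only [norm_mul, norm_real, Real.norm_of_nonneg (weight_nonneg s)]
    exact mul_le_mul_of_nonneg_right (hM u hu s ⟨hs.1.le, hs.2⟩) (weight_nonneg s)
  · filter_upwards [MeasureTheory.volume.ae_ne (1 : ℝ)] with s hs1 hs
    rw [Set.uIoc_of_le zero_le_one] at hs
    have hs' : s ∈ Set.Ioo (0 : ℝ) 1 := ⟨hs.1, lt_of_le_of_ne hs.2 hs1⟩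
    have hgap' : -l * u₀ * (1 + y * u₀) < 1 + y * u₀ ^ 3 := by
      rcases hu₀.1.eq_or_lt with h | h
      · rw [← h]; norm_num
      · exact hgap u₀ h
    have hslit := radPoly_mem_slitPlane hlp hl hp hy hu₀.1 hgap' hs'
    have hα := continuousAt_branchRe l hy hu₀.1
    have hN : ContinuousAt (fun u => zeroPoly l y u (segPoint l p s)) u₀ := by
      unfold zeroPoly; fun_prop
    have hD : ContinuousAt (fun u => radPoly l y u (segPoint l p s)) u₀ := by
      unfold radPoly; fun_prop
    exact (((hN.mul (hD.cpow continuousAt_const hslit)).div_const _).mul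
      continuousAt_const).continuousWithinAt

lemma segIntegral_zero_pos (l p y : ℝ) (hl : l < 0) (hy : 0 < y) :
    0 < (segIntegral l p y 0).re := by
  rw [segIntegral_re p hl hy le_rfl]
  refine intervalIntegral.intervalIntegral_pos_of_pos_on
    (intervalIntegrable_re_regDensity p hl hy le_rfl) (fun s hs => ?_) zero_lt_one
  have hk := segPoint_ne_zero hl p s
  have : regDensity l y 0 (segPoint l p s) = 1 := by
    simp [regDensity, zeroPoly, radPoly, branchRe, hk]
  rw [this, one_re, one_mul]
  exact weight_pos hs

/-- At `u = 1` one has `d = E`, the square root is `1`, and the integrand has an elementary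
primitive. -/
lemma segIntegral_one {l p y : ℝ} (hlp : p ^ 2 + l ^ 2 = 1) (hl : l < 0) (hp : 0 < p)
    (hy : 0 < y) : segIntegral l p y 1 = ((2 * p * (1 - y) : ℝ) : ℂ) := by
  have hα : branchRe l y 1 = l := by
    have : 1 + y ≠ 0 := by positivity
    rw [branchRe, mul_one, one_pow, mul_one, mul_div_assoc, div_self this, mul_one]
  have hpt : ∀ s ∈ Set.Ioo (0 : ℝ) 1, regDensity l y 1 (segPoint l p s) * (weight s : ℂ) =
      2 * p * (1 - y / segPoint l p s ^ 2) := by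
    intro s hs
    have hk := segPoint_ne_zero hl p s
    have h0 : 0 < s * (1 - s) := mul_pos hs.1 (sub_pos.mpr hs.2)
    have hsq := Real.sqrt_pos.mpr h0
    have hlp' : (p : ℂ) ^ 2 + (l : ℂ) ^ 2 = 1 := by exact_mod_cast hlp
    have hD : radPoly l y 1 (segPoint l p s) = (((2 * p) ^ 2 * (s * (1 - s)) : ℝ) : ℂ) := by
      rw [radPoly, hα, segPoint]
      push_cast
      linear_combination (p : ℂ) ^ 2 * (1 - 2 * s) ^ 2 * I_sq - hlp'
    have hR : radPoly l y 1 (segPoint l p s) ^ (1 / 2 : ℂ) =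
        ((2 * p * √(s * (1 - s)) : ℝ) : ℂ) := by
      have e : (1 / 2 : ℂ) = ((1 / 2 : ℝ) : ℂ) := by push_cast; rfl
      rw [hD, e, ← ofReal_cpow (by positivity), ← Real.sqrt_eq_rpow,
        Real.sqrt_mul (by positivity), Real.sqrt_sq (by positivity)]
    have hN : zeroPoly l y 1 (segPoint l p s) = segPoint l p s ^ 2 - y := by
      rw [zeroPoly, hα]; simp
    rw [regDensity, hR, hN, weight]
    have : ((√(s * (1 - s)) : ℝ) : ℂ) ≠ 0 := by exact_mod_cast hsq.ne'
    push_cast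
    field_simp
  have hp' : (p : ℂ) ≠ 0 := by exact_mod_cast hp.ne'
  rw [segIntegral, intervalIntegral.integral_congr_Ioo_of_le zero_le_one hpt]
  have hder : ∀ s : ℝ, HasDerivAt (fun s : ℝ => 2 * p * (s : ℂ) + y * I / segPoint l p s)
      (2 * p * (1 - y / segPoint l p s ^ 2)) s := by
    intro s
    have hk := segPoint_ne_zero hl p s
    have hid : HasDerivAt (fun s : ℝ => (s : ℂ)) 1 s := by
      simpa using (hasDerivAt_id s).ofReal_comp
    have hkd : HasDerivAt (segPoint l p) (-2 * p * I) s := by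
      have h :=
        ((((hid.const_mul 2).const_sub 1).const_mul (p : ℂ)).mul_const I).const_add (l : ℂ)
      refine (h.congr_of_eventuallyEq (Filter.Eventually.of_forall fun v => ?_)).congr_deriv ?_
      · simp [segPoint]
      · ring
    refine ((hid.const_mul (2 * p : ℂ)).add
      (((hasDerivAt_const s ((y : ℂ) * I)).div hkd hk))).congr_deriv ?_
    field_simp
    linear_combination (2 * y * p : ℂ) * I_sq
  rw [intervalIntegral.integral_eq_sub_of_hasDerivAt (fun s _ => hder s)]
  · have h0 : segPoint l p 0 ≠ 0 := segPoint_ne_zero hl p 0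
    have h1 : segPoint l p 1 ≠ 0 := segPoint_ne_zero hl p 1
    have hlp' : (p : ℂ) ^ 2 + (l : ℂ) ^ 2 = 1 := by exact_mod_cast hlp
    have hprod : segPoint l p 0 * segPoint l p 1 = 1 := by
      simp only [segPoint]; push_cast
      linear_combination hlp' - (p : ℂ) ^ 2 * I_sq
    have hinv : 1 / segPoint l p 1 = segPoint l p 0 := by
      rw [div_eq_iff h1, hprod]
    have hinv' : 1 / segPoint l p 0 = segPoint l p 1 := by
      rw [div_eq_iff h0, mul_comm, hprod]
    have a1 : (y : ℂ) * I / segPoint l p 1 = y * I * segPoint l p 0 := by rw [← hinv]; ring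
    have a0 : (y : ℂ) * I / segPoint l p 0 = y * I * segPoint l p 1 := by rw [← hinv']; ring
    rw [a1, a0]
    simp only [segPoint]; push_cast
    linear_combination (2 * y * p : ℂ) * I_sq
  · refine Continuous.intervalIntegrable ?_ 0 1
    have := continuous_segPoint l p
    exact continuous_const.mul (continuous_const.sub (continuous_const.div (this.pow 2)
      fun s => pow_ne_zero 2 (segPoint_ne_zero hl p s)))

lemma exists_segIntegral_eq_zero {l p y : ℝ} (hlp : p ^ 2 + l ^ 2 = 1) (hl : l < 0)
    (hp : 0 < p) (hy : 1 < y)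
    (hgap : ∀ u : ℝ, 0 < u → -l * u * (1 + y * u) < 1 + y * u ^ 3) :
    ∃ u : ℝ, 0 < u ∧ segIntegral l p y u = 0 := by
  have hy0 := zero_lt_one.trans hy
  have hc : ContinuousOn (fun u => (segIntegral l p y u).re) (Set.Icc 0 1) :=
    continuous_re.comp_continuousOn (continuousOn_segIntegral hlp hl hp hy0 hgap)
  have h1 : (segIntegral l p y 1).re < 0 := by
    rw [segIntegral_one hlp hl hp hy0, ofReal_re]
    nlinarith
  have h0 := segIntegral_zero_pos l p y hl hy0
  obtain ⟨u, hu, hu0⟩ := intermediate_value_Icc' zero_le_one hc ⟨h1.le, h0.le⟩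
  have hpos : 0 < u := by
    refine lt_of_le_of_ne hu.1 fun h => ?_
    rw [← h] at hu0
    exact h0.ne' hu0
  exact ⟨u, hpos, Complex.ext hu0 (segIntegral_im hlp hl hp hy0 hpos.le (hgap u hpos))⟩

lemma eq_of_segIntegral_eq_zero {l p y : ℝ} (hlp : p ^ 2 + l ^ 2 = 1) (hl : l < 0)
    (hp : 0 < p) (hy : 0 < y)
    (hgap : ∀ u : ℝ, 0 < u → -l * u * (1 + y * u) < 1 + y * u ^ 3) {u v : ℝ}
    (hu : 0 < u) (hv : 0 < v) (hu0 : segIntegral l p y u = 0) (hv0 : segIntegral l p y v = 0) :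
    u = v := by
  rcases lt_trichotomy u v with h | h | h
  · have := segIntegral_re_div_lt hlp hl hp hy hgap hu h
    simp [hu0, hv0] at this
  · exact h
  · have := segIntegral_re_div_lt hlp hl hp hy hgap hv h
    simp [hu0, hv0] at this

/-! ### Reduction of the system to one equation -/

/-- The two principal roots defining `rootRatio` combine to one on the segment: their radicands lie
on opposite sides of the real axis, except for `d = E`, when both are positive. -/
lemma rootRatio_segPoint {l p y u b : ℝ} (hlp : p ^ 2 + l ^ 2 = 1) (hl : l < 0) (hp : 0 < p)
    (hy : 0 < y) (hu : 0 < u) (hb : 0 < b) (hbu : u ^ 2 * (branchRe l y u ^ 2 + b ^ 2) = 1)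
    {s : ℝ} (hs : s ∈ Set.Ioo (0 : ℝ) 1) :
    rootRatio (l + p * I) (branchRe l y u + b * I) (segPoint l p s) =
      radPoly l y u (segPoint l p s) ^ (1 / 2 : ℂ) * (weight s : ℂ) / (2 * p * u) := by
  have hs1 : 0 < 1 - s := sub_pos.mpr hs.2
  have hs0 : 0 < s := hs.1
  have h0 : 0 < s * (1 - s) := mul_pos hs0 hs1
  have hsq := Real.sqrt_pos.mpr h0
  set α := branchRe l y u with hα
  set t := p * (1 - 2 * s) with ht
  have hpC : (p : ℂ) ≠ 0 := by exact_mod_cast hp.ne'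
  have huC : (u : ℂ) ≠ 0 := by exact_mod_cast hu.ne'
  have hsC : (s : ℂ) ≠ 0 := by exact_mod_cast hs0.ne'
  have hs1C : (1 - s : ℂ) ≠ 0 := by exact_mod_cast hs1.ne'
  have hz1 : (segPoint l p s - (α + b * I)) / (segPoint l p s - (l + p * I)) =
      (((b - t) / (2 * p * s) : ℝ) : ℂ) + (((l - α) / (2 * p * s) : ℝ) : ℂ) * I := by
    have e : segPoint l p s - (l + p * I) = -(2 * p * s) * I := by
      rw [segPoint]; push_cast; ring
    rw [e, segPoint, ht]; push_cast
    field_simp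
    linear_combination (-((l : ℂ) - α)) * I_sq
  have hz2 : (segPoint l p s - conj (α + b * I : ℂ)) / (segPoint l p s - conj (l + p * I : ℂ)) =
      (((b + t) / (2 * p * (1 - s)) : ℝ) : ℂ) + ((-(l - α) / (2 * p * (1 - s)) : ℝ) : ℂ) * I := by
    simp only [map_add, map_mul, conj_I, conj_ofReal]
    have e : segPoint l p s - (l + p * -I) = (2 * p * (1 - s)) * I := by
      rw [segPoint]; push_cast; ring
    rw [e, segPoint, ht]; push_cast
    field_simp
    linear_combination ((l : ℂ) - α) * I_sq
  have hprod : ((((b - t) / (2 * p * s) : ℝ) : ℂ) + (((l - α) / (2 * p * s) : ℝ) : ℂ) * I) *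
      ((((b + t) / (2 * p * (1 - s)) : ℝ) : ℂ) + ((-(l - α) / (2 * p * (1 - s)) : ℝ) : ℂ) * I) =
      ((1 / ((2 * p * u) ^ 2 * (s * (1 - s))) : ℝ) : ℂ) * radPoly l y u (segPoint l p s) := by
    have hbu' : (u : ℂ) ^ 2 * ((α : ℂ) ^ 2 + (b : ℂ) ^ 2) = 1 := by exact_mod_cast hbu
    rw [radPoly, ← hα, ← hbu', segPoint, ← ht]
    push_cast
    field_simp
    linear_combination (-((l : ℂ) - α) ^ 2 - t ^ 2) * I_sq
  have hopp := fun hcase => mul_cpow_of_opposite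
    (x := (((b - t) / (2 * p * s) : ℝ) : ℂ) + (((l - α) / (2 * p * s) : ℝ) : ℂ) * I)
    (y := (((b + t) / (2 * p * (1 - s)) : ℝ) : ℂ) + ((-(l - α) / (2 * p * (1 - s)) : ℝ) : ℂ) * I)
    hcase (1 / 2 : ℂ)
  rw [rootRatio, hz1, hz2, ← hopp, hprod]
  · have hc : 0 < 1 / ((2 * p * u) ^ 2 * (s * (1 - s))) := by positivity
    by_cases hD : radPoly l y u (segPoint l p s) = 0
    · rw [hD, mul_zero, zero_cpow (by norm_num)]; simp
    rw [mul_cpow_of_arg_add_mem (by exact_mod_cast hc.ne') hD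
      (by rw [arg_ofReal_of_nonneg hc.le, zero_add]; exact arg_mem_Ioc _)]
    have e : (1 / 2 : ℂ) = ((1 / 2 : ℝ) : ℂ) := by push_cast; rfl
    have hroot : (1 / ((2 * p * u) ^ 2 * (s * (1 - s)))) ^ (1 / 2 : ℝ) =
        weight s / (2 * p * u) := by
      rw [← Real.sqrt_eq_rpow, one_div, Real.sqrt_inv, Real.sqrt_mul (by positivity),
        Real.sqrt_sq (by positivity), weight, mul_inv]
      ring
    rw [e, ← ofReal_cpow hc.le, hroot]
    push_cast
    ring
  · have i1 : ((((b - t) / (2 * p * s) : ℝ) : ℂ) + (((l - α) / (2 * p * s) : ℝ) : ℂ) * I).im =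
        (l - α) / (2 * p * s) := by simp [-ofReal_div]
    have i2 : ((((b + t) / (2 * p * (1 - s)) : ℝ) : ℂ) +
        ((-(l - α) / (2 * p * (1 - s)) : ℝ) : ℂ) * I).im = -(l - α) / (2 * p * (1 - s)) := by
      simp [-ofReal_div]
    have r1 : ((((b - t) / (2 * p * s) : ℝ) : ℂ) + (((l - α) / (2 * p * s) : ℝ) : ℂ) * I).re =
        (b - t) / (2 * p * s) := by simp [-ofReal_div]
    have r2 : ((((b + t) / (2 * p * (1 - s)) : ℝ) : ℂ) +
        ((-(l - α) / (2 * p * (1 - s)) : ℝ) : ℂ) * I).re = (b + t) / (2 * p * (1 - s)) := by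
      simp [-ofReal_div]
    rw [i1, i2, r1, r2]
    have q1 : 0 < 2 * p * s := by positivity
    have q2 : 0 < 2 * p * (1 - s) := by positivity
    rcases lt_trichotomy (l - α) 0 with h | h | h
    · exact Or.inr (Or.inl ⟨div_neg_of_neg_of_pos h q1, div_pos (neg_pos.mpr h) q2⟩)
    · have hαl : α = l := by linarith
      have hu1 : u = 1 := eq_one_of_branchRe_eq hl hy hu hαl
      have hbp : b = p := by
        rw [hu1, hαl] at hbu
        exact (sq_eq_sq₀ hb.le hp.le).mp (by linarith)
      refine Or.inr (Or.inr ⟨by rw [h, zero_div], by rw [h, neg_zero, zero_div],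
        div_pos ?_ q1, div_pos ?_ q2⟩)
      · rw [hbp, ht]; nlinarith
      · rw [hbp, ht]; nlinarith
    · exact Or.inl ⟨div_pos h q1, div_neg_of_neg_of_pos (neg_neg_of_pos h) q2⟩

lemma gHatPullback_eq {l p ξ u b lm lp : ℝ} (hlp : p ^ 2 + l ^ 2 = 1) (hl : l < 0) (hp : 0 < p)
    (hξ : 0 < ξ) (hu : 0 < u) (hb : 0 < b)
    (hbu : u ^ 2 * (branchRe l (ξ ^ 2) u ^ 2 + b ^ 2) = 1)
    (hsum : lm + lp = l - branchRe l (ξ ^ 2) u) (hprod : lm * lp = -(ξ ^ 2 * u))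
    {s : ℝ} (hs : s ∈ Set.Ioo (0 : ℝ) 1) :
    gHatPullback (l + p * I) ξ lm lp (branchRe l (ξ ^ 2) u + b * I) s =
      -(I / (4 * ξ ^ 2 * u)) *
        (regDensity l (ξ ^ 2) u (segPoint l p s) * (weight s : ℂ)) := by
  have e1 : conj (l + p * I : ℂ) - (l + p * I) = -2 * p * I := by
    simp only [map_add, map_mul, conj_I, conj_ofReal]; ring
  have e2 : (l + p * I : ℂ) + s * (-2 * p * I) = segPoint l p s := by
    rw [segPoint]; push_cast; ring
  rw [gHatPullback, e1, e2, gHatDensity,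
    rootRatio_segPoint hlp hl hp (by positivity : 0 < ξ ^ 2) hu hb hbu hs, regDensity]
  have hN : (segPoint l p s - lm) * (segPoint l p s - lp) =
      zeroPoly l (ξ ^ 2) u (segPoint l p s) := by
    rw [zeroPoly, ← hsum]
    have : (lm : ℂ) * lp = -(ξ ^ 2 * u) := by exact_mod_cast hprod
    push_cast
    linear_combination this
  rw [hN]
  have hk := segPoint_ne_zero hl p s
  have hpC : (p : ℂ) ≠ 0 := by exact_mod_cast hp.ne'
  have huC : (u : ℂ) ≠ 0 := by exact_mod_cast hu.ne'
  have hξC : (ξ : ℂ) ≠ 0 := by exact_mod_cast hξ.ne'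
  field_simp

lemma gHatPullback_integrable_and_integral {l p ξ u b lm lp : ℝ}
    (hlp : p ^ 2 + l ^ 2 = 1) (hl : l < 0) (hp : 0 < p) (hξ : 0 < ξ) (hu : 0 < u) (hb : 0 < b)
    (hbu : u ^ 2 * (branchRe l (ξ ^ 2) u ^ 2 + b ^ 2) = 1)
    (hsum : lm + lp = l - branchRe l (ξ ^ 2) u) (hprod : lm * lp = -(ξ ^ 2 * u)) :
    IntervalIntegrable (gHatPullback (l + p * I) ξ lm lp (branchRe l (ξ ^ 2) u + b * I))
      MeasureTheory.volume 0 1 ∧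
    ∫ s in (0 : ℝ)..1, gHatPullback (l + p * I) ξ lm lp (branchRe l (ξ ^ 2) u + b * I) s =
      -(I / (4 * ξ ^ 2 * u)) * segIntegral l p (ξ ^ 2) u := by
  constructor
  · refine ((intervalIntegrable_regDensity p hl (by positivity : 0 < ξ ^ 2) hu.le).const_mul
      (-(I / (4 * ξ ^ 2 * u)))).congr_uIoo fun s hs => ?_
    rw [Set.uIoo_of_le zero_le_one] at hs
    exact (gHatPullback_eq hlp hl hp hξ hu hb hbu hsum hprod hs).symm
  · rw [segIntegral, ← intervalIntegral.integral_const_mul]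
    exact intervalIntegral.integral_congr_Ioo_of_le zero_le_one fun s hs =>
      gHatPullback_eq hlp hl hp hξ hu hb hbu hsum hprod hs

/-- For `|E| = 1` the system reduces to the single equation `segIntegral = 0` for `1 / |d|`: the
third algebraic equation is linear in `Re d` once the first two are substituted. -/
lemma isWhithamSolution_unit_iff {l p ξ lm lp : ℝ} {d : ℂ} (hlp : p ^ 2 + l ^ 2 = 1) (hl : l < 0)
    (hp : 0 < p) (hξ : 0 < ξ) :
    IsWhithamSolution (l + p * I) ξ lm lp d ↔ lm < lp ∧ 0 < d.im ∧
      d.re = branchRe l (ξ ^ 2) ‖d‖⁻¹ ∧ lm + lp = l - d.re ∧ lm * lp = -(ξ ^ 2 * ‖d‖⁻¹) ∧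
      segIntegral l p (ξ ^ 2) ‖d‖⁻¹ = 0 := by
  have hre : (l + p * I : ℂ).re = l := by simp
  have hnorm : ‖(l + p * I : ℂ)‖ = 1 := by
    rw [norm_add_mul_I, add_comm, hlp, Real.sqrt_one]
  have hint : 0 < d.im → d.re = branchRe l (ξ ^ 2) ‖d‖⁻¹ → lm + lp = l - d.re →
      lm * lp = -(ξ ^ 2 * ‖d‖⁻¹) →
      IntervalIntegrable (gHatPullback (l + p * I) ξ lm lp d) MeasureTheory.volume 0 1 ∧
      ∫ s in (0 : ℝ)..1, gHatPullback (l + p * I) ξ lm lp d s =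
        -(I / (4 * ξ ^ 2 * (‖d‖⁻¹ : ℝ))) * segIntegral l p (ξ ^ 2) ‖d‖⁻¹ := by
    intro hd ha hsum hprod
    have hd0 : d ≠ 0 := fun h => by simp [h] at hd
    have hr : 0 < ‖d‖ := norm_pos_iff.mpr hd0
    have hbu : ‖d‖⁻¹ ^ 2 * (branchRe l (ξ ^ 2) ‖d‖⁻¹ ^ 2 + d.im ^ 2) = 1 := by
      have := Complex.sq_norm d
      rw [normSq_apply] at this
      rw [← ha, inv_pow, inv_mul_eq_one₀ (by positivity), this]; ring
    have h := gHatPullback_integrable_and_integral (lm := lm) (lp := lp) hlp hl hp hξ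
      (inv_pos.mpr hr) hd hbu (by rw [hsum, ha]) hprod
    have hdd : ((branchRe l (ξ ^ 2) ‖d‖⁻¹ : ℝ) : ℂ) + d.im * I = d := by rw [← ha, re_add_im]
    rwa [hdd] at h
  constructor
  · intro h
    have hd := h.im_pos
    have hd0 : d ≠ 0 := fun h => by simp [h] at hd
    have hr : 0 < ‖d‖ := norm_pos_iff.mpr hd0
    have hsum := h.sum_eq
    have hprod := h.prod_eq
    have hthird := h.third_eq
    rw [hre] at hsum hthird
    rw [hnorm] at hprod hthird
    have hprod' : lm * lp = -(ξ ^ 2 * ‖d‖⁻¹) := by rw [hprod]; ring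
    have ha : d.re = branchRe l (ξ ^ 2) ‖d‖⁻¹ := by
      rw [hsum, hprod'] at hthird
      have hA : 1 + ξ ^ 2 * ‖d‖⁻¹ ^ 3 ≠ 0 := by positivity
      rw [branchRe, eq_div_iff hA]
      field_simp at hthird ⊢
      linear_combination -hthird
    obtain ⟨_, h2⟩ := hint hd ha hsum hprod'
    rw [h.integral_eq] at h2
    have hc : -(I / (4 * (ξ : ℂ) ^ 2 * (‖d‖⁻¹ : ℝ))) ≠ 0 := by
      have h1 : (ξ : ℂ) ≠ 0 := by exact_mod_cast hξ.ne'
      have h2 : ((‖d‖⁻¹ : ℝ) : ℂ) ≠ 0 := by exact_mod_cast (inv_pos.mpr hr).ne'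
      exact neg_ne_zero.mpr (div_ne_zero I_ne_zero
        (mul_ne_zero (mul_ne_zero (by norm_num) (pow_ne_zero 2 h1)) h2))
    exact ⟨h.lt, hd, ha, hsum, hprod', (mul_eq_zero.mp h2.symm).resolve_left hc⟩
  · rintro ⟨hlt, hd, ha, hsum, hprod, hJ⟩
    have hd0 : d ≠ 0 := fun h => by simp [h] at hd
    have hr : 0 < ‖d‖ := norm_pos_iff.mpr hd0
    obtain ⟨h1, h2⟩ := hint hd ha hsum hprod
    refine ⟨hlt, hd, by rw [hre, hsum], by rw [hnorm, hprod]; ring, ?_, h1,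
      by rw [h2, hJ, mul_zero]⟩
    rw [hsum, hprod, hre, hnorm]
    have hA : 1 + ξ ^ 2 * ‖d‖⁻¹ ^ 3 ≠ 0 := by positivity
    rw [branchRe, eq_div_iff hA] at ha
    field_simp at ha ⊢
    linear_combination -ha

/-! ### Existence and uniqueness -/

/-- Ordered pairs are determined by their sum and product. -/
lemma pair_eq_of_sum_prod {a b c d : ℝ} (hab : a < b) (hcd : c < d) (hs : a + b = c + d)
    (hm : a * b = c * d) : a = c ∧ b = d := by
  have h : (a - c) * (a - d) = 0 := by
    have : b = c + d - a := by linarith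
    rw [this] at hm
    linarith
  rcases mul_eq_zero.mp h with h | h
  · exact ⟨by linarith, by linarith⟩
  · linarith

lemma existsUnique_unit {l p ξ : ℝ} (hlp : p ^ 2 + l ^ 2 = 1) (hl : l < 0)
    (hp : 0 < p) (hξ : 1 < ξ)
    (hgap : ∀ u : ℝ, 0 < u → -l * u * (1 + ξ ^ 2 * u) < 1 + ξ ^ 2 * u ^ 3) :
    ∃! q : ℝ × ℝ × ℂ, IsWhithamSolution (l + p * I) ξ q.1 q.2.1 q.2.2 := by
  have hξ0 : 0 < ξ := zero_lt_one.trans hξ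
  have hy : 1 < ξ ^ 2 := by nlinarith
  have hy0 : 0 < ξ ^ 2 := by positivity
  obtain ⟨u, hu, hJ⟩ := exists_segIntegral_eq_zero hlp hl hp hy hgap
  set α := branchRe l (ξ ^ 2) u with hα
  have hαu : (u * α) ^ 2 < 1 := sq_mul_branchRe_lt_one hl hy0 hu (hgap u hu)
  have hb2 : 0 < (u ^ 2)⁻¹ - α ^ 2 := by
    rw [sub_pos, ← one_div, lt_div_iff₀ (by positivity)]
    linarith
  set b := √((u ^ 2)⁻¹ - α ^ 2) with hb
  have hb0 : 0 < b := Real.sqrt_pos.mpr hb2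
  have hbsq : b ^ 2 = (u ^ 2)⁻¹ - α ^ 2 := Real.sq_sqrt hb2.le
  have hnorm : ‖(α + b * I : ℂ)‖⁻¹ = u := by
    rw [norm_add_mul_I, hbsq, add_sub_cancel, Real.sqrt_inv, inv_inv, Real.sqrt_sq hu.le]
  have hdisc : 0 < (l - α) ^ 2 + 4 * (ξ ^ 2 * u) := by positivity
  set D := √((l - α) ^ 2 + 4 * (ξ ^ 2 * u)) with hD
  have hD0 : 0 < D := Real.sqrt_pos.mpr hdisc
  have hDsq : D ^ 2 = (l - α) ^ 2 + 4 * (ξ ^ 2 * u) := Real.sq_sqrt hdisc.le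
  have hre : (α + b * I : ℂ).re = α := by simp
  have him : (α + b * I : ℂ).im = b := by simp
  refine ⟨((l - α - D) / 2, (l - α + D) / 2, α + b * I), ?_, ?_⟩
  · refine (isWhithamSolution_unit_iff hlp hl hp hξ0).mpr ?_
    rw [hnorm, hre, him]
    exact ⟨by linarith, hb0, rfl, by ring, by linear_combination (-1 / 4) * hDsq, hJ⟩
  · rintro ⟨lm, lp, d⟩ h
    obtain ⟨hlt, hd, ha, hsum, hprod, hJ'⟩ := (isWhithamSolution_unit_iff hlp hl hp hξ0).mp h
    dsimp only at hlt hd ha hsum hprod hJ'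
    have hd0 : d ≠ 0 := fun h => by simp [h] at hd
    have hr : 0 < ‖d‖⁻¹ := inv_pos.mpr (norm_pos_iff.mpr hd0)
    have hur : ‖d‖⁻¹ = u := eq_of_segIntegral_eq_zero hlp hl hp hy0 hgap hr hu hJ' hJ
    rw [hur] at ha hprod
    have hde : d = α + b * I := by
      refine Complex.ext (by rw [hre, ha]) ?_
      rw [him]
      refine (sq_eq_sq₀ hd.le hb0.le).mp ?_
      have := Complex.sq_norm d
      rw [normSq_apply, ha, ← hα] at this
      rw [hbsq, ← hur, inv_pow, inv_inv, this]; ring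
    obtain ⟨h1, h2⟩ := pair_eq_of_sum_prod (c := (l - α - D) / 2) (d := (l - α + D) / 2) hlt
      (by linarith) (by rw [hsum, ha]; ring) (by rw [hprod]; linear_combination (1 / 4) * hDsq)
    rw [h1, h2, hde]

lemma IsWhithamSolution.scale {E d : ℂ} {ξ lm lp : ℝ} (h : IsWhithamSolution E ξ lm lp d)
    {c : ℝ} (hc : 0 < c) :
    IsWhithamSolution (c * E) (c * ξ) (c * lm) (c * lp) (c * d) := by
  have hcC : (c : ℂ) ≠ 0 := by exact_mod_cast hc.ne'
  have hn : ∀ z : ℂ, ‖(c : ℂ) * z‖ = c * ‖z‖ := fun z => by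
    rw [norm_mul, norm_real, Real.norm_of_nonneg hc.le]
  have hpull : gHatPullback (c * E) (c * ξ : ℝ) (c * lm) (c * lp) (c * d) =
      fun s => (c : ℂ)⁻¹ * gHatPullback E ξ lm lp d s := by
    funext s
    have e1 : conj (c * E) - c * E = c * (conj E - E) := by
      rw [map_mul, conj_ofReal]; ring
    have e2 : c * E + s * (c * (conj E - E)) = c * (E + s * (conj E - E)) := by ring
    rw [gHatPullback, e1, e2, gHatPullback]
    generalize E + s * (conj E - E) = k
    rw [gHatDensity, gHatDensity, rootRatio, rootRatio]
    simp only [map_mul, conj_ofReal, ← mul_sub, mul_div_mul_left _ _ hcC]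
    push_cast
    rw [← mul_sub, ← mul_sub]
    have : (c * (k - lm) * (c * (k - lp)) : ℂ) / (4 * (c * ξ) ^ 2 * (c * k) ^ 2) =
      (c : ℂ)⁻¹ ^ 2 * ((k - lm) * (k - lp) / (4 * (ξ : ℂ) ^ 2 * k ^ 2)) := by
      rw [show (c * (k - lm) * (c * (k - lp)) : ℂ) = c ^ 2 * ((k - lm) * (k - lp)) by ring,
        show (4 * (c * ξ) ^ 2 * (c * k) ^ 2 : ℂ) = c ^ 2 * (c ^ 2 * (4 * (ξ : ℂ) ^ 2 * k ^ 2)) by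
          ring, mul_div_mul_left _ _ (pow_ne_zero 2 hcC), ← div_div, div_right_comm, inv_pow,
        div_eq_inv_mul _ ((c : ℂ) ^ 2)]
    rw [this]
    field_simp
  refine ⟨mul_lt_mul_of_pos_left h.lt hc, ?_, ?_, ?_, ?_, ?_, ?_⟩
  · rw [im_ofReal_mul]; exact mul_pos hc h.im_pos
  · rw [re_ofReal_mul, re_ofReal_mul, ← mul_add, h.sum_eq]; ring
  · rw [hn, hn, mul_div_mul_left _ _ hc.ne']
    linear_combination c ^ 2 * h.prod_eq
  · have hd0 : d ≠ 0 := fun h0 => by simpa [h0] using h.im_pos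
    rw [hn, hn, re_ofReal_mul, re_ofReal_mul, mul_div_mul_left _ _ hc.ne',
      mul_div_mul_left _ _ hc.ne']
    linear_combination c ^ 3 * h.third_eq
  · rw [hpull]; exact h.integrable.const_mul _
  · rw [hpull, intervalIntegral.integral_const_mul, h.integral_eq, mul_zero]

lemma gap_of_lt_omegaZero {l ω ξ : ℝ} (hl_gt : -1 < l) (hl_neg : l < 0) (hω : 0 < ω)
    (hξ : 1 / (2 * ω) < ξ) (hξ₀ : ξ < 1 / (2 * omegaZero l ω)) {u : ℝ} (hu : 0 < u) :
    -l * u * (1 + (2 * ω * ξ) ^ 2 * u) < 1 + (2 * ω * ξ) ^ 2 * u ^ 3 := by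
  have hx : 1 < 2 * ω * ξ := by
    rw [div_lt_iff₀ (by positivity)] at hξ
    linarith
  have hξ0 : 0 < ξ := lt_trans (by positivity) hξ
  have hl1 : l ^ 2 < 1 := by nlinarith
  refine gap_of_lt (neg_pos.mpr hl_neg) (by linarith) (by nlinarith) hu ?_
  rw [neg_sq, show (-l) ^ 4 = l ^ 4 by ring]
  rw [omegaZero] at hξ₀
  set s := √((1 - l ^ 2) * (9 - l ^ 2))
  have hs : 0 ≤ s := Real.sqrt_nonneg _
  set N := 27 - 18 * l ^ 2 - l ^ 4 + (9 - l ^ 2) * s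
  have hN : 0 < N := by
    have h1 : 0 < 27 - 18 * l ^ 2 - l ^ 4 := by nlinarith
    have h2 : 0 ≤ (9 - l ^ 2) * s := mul_nonneg (by linarith) hs
    linarith
  have hl3 : 0 < -8 * l ^ 3 := by nlinarith [pow_pos (neg_pos.mpr hl_neg) 3]
  have hQ : 0 < -8 * l ^ 3 * ω ^ 2 / N := by positivity
  have hw := Real.sqrt_pos.mpr hQ
  rw [lt_div_iff₀ (by positivity)] at hξ₀
  have hsq : (ξ * (2 * √(-8 * l ^ 3 * ω ^ 2 / N))) ^ 2 < 1 := by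
    rw [sq_lt_one_iff_abs_lt_one, abs_of_pos (by positivity)]
    exact hξ₀
  rw [mul_pow, mul_pow, Real.sq_sqrt hQ.le] at hsq
  have : ξ ^ 2 * (2 ^ 2 * (-8 * l ^ 3 * ω ^ 2 / N)) = (8 * (-l) ^ 3 * (2 * ω * ξ) ^ 2) / N := by
    ring
  rw [this, div_lt_one hN] at hsq
  exact hsq

end RamanWhitham

theorem mainTheorem1 (l p ω ξ : ℝ) (hlp : p ^ 2 + l ^ 2 = 1) (hl_gt : -1 < l) (hl_neg : l < 0)
    (hp : 0 < p) (hω : 0 < ω)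
    (hξ : 1 / (2 * ω) < ξ) (hξ₀ : ξ < 1 / (2 * RamanWhitham.omegaZero l ω)) :
    ∃! q : ℝ × ℝ × ℂ,
      RamanWhitham.IsWhithamSolution (RamanWhitham.endPoint l p ω) ξ q.1 q.2.1 q.2.2 := by
  have hx : 1 < 2 * ω * ξ := by
    rw [div_lt_iff₀ (by positivity)] at hξ
    linarith
  have hωC : (ω : ℂ) ≠ 0 := by exact_mod_cast hω.ne'
  have hc : 0 < 2 * ω := by positivity
  have hE : RamanWhitham.endPoint l p ω = (((2 * ω)⁻¹ : ℝ) : ℂ) * (l + p * Complex.I) := by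
    rw [RamanWhitham.endPoint]; push_cast; ring
  have hE' : ((2 * ω : ℝ) : ℂ) * RamanWhitham.endPoint l p ω = l + p * Complex.I := by
    rw [RamanWhitham.endPoint]; push_cast; field_simp
  obtain ⟨⟨lm, lp, d⟩, hq, huniq⟩ := RamanWhitham.existsUnique_unit hlp hl_neg hp hx
    fun u hu => RamanWhitham.gap_of_lt_omegaZero hl_gt hl_neg hω hξ hξ₀ hu
  refine ⟨((2 * ω)⁻¹ * lm, (2 * ω)⁻¹ * lp, (((2 * ω)⁻¹ : ℝ) : ℂ) * d), ?_, ?_⟩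
  · have h := hq.scale (inv_pos.mpr hc)
    rw [← hE, inv_mul_cancel_left₀ hc.ne'] at h
    exact h
  · rintro ⟨lm', lp', d'⟩ h
    have h' := RamanWhitham.IsWhithamSolution.scale h hc
    rw [hE'] at h'
    have := huniq (2 * ω * lm', 2 * ω * lp', ((2 * ω : ℝ) : ℂ) * d') h'
    simp only [Prod.mk.injEq] at this
    obtain ⟨rfl, rfl, rfl⟩ := this
    have hcC : ((2 * ω : ℝ) : ℂ) ≠ 0 := by exact_mod_cast hc.ne'
    rw [inv_mul_cancel_left₀ hc.ne', inv_mul_cancel_left₀ hc.ne', Complex.ofReal_inv,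
      inv_mul_cancel_left₀ hcC]
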